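/- **Conventions.** A *point* of a matroid $M$ is a rank-one flat (an element, if $M$ is simple); a set of points is *collinear* if its union has rank at most $2$. A *harmonic configuration* $\mathrm{HP}(d,e,f;a_1,a_2,a_3,a_4)$ consists of three distinct collinear points $d,e,f$ on a line $l$ and four points $a_1,\dots,a_4$ not on $l$, no three of them collinear, such that $\{d,a_1,a_2\}$, $\{d,a_4,a_3\}$, $\{e,a_4,a_2\}$, $\{f,a_4,a_1\}$, $\{f,a_3,a_2\}$ are collinear. If there is such a configuration based on $(d,e,f)$, and there is a point $h$ that for every such configuration makes $\{a_1,a_3,h\}$ and $\{d,e,f,h\}$ collinear, then $h$ is the *harmonic conjugate* of $e$ with respect to $d$ and $f$, written $\mathrm{Hc}(d,f;e,h)$. $M$ is *harmonic* if a harmonic conjugate exists for every harmonic configuration in $M$. For a set $S$ of points let $\mathrm h(S)=S\cup\{x:\mathrm{Hc}(a,c;b,x)\text{ for some }a,b,c\in S\}$; the *harmonic closure* of $S$ is $\mathrm h^\infty(S)=\bigcup_{n\ge 0}\mathrm h^n(S)$. Let $p$ be a prime and $V$ a nonzero vector space over $\mathbb Z_p$, of any dimension. $L_p^V$ is the simple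 matroid of rank $3$ on the distinct elements $D,a_g,b_g,c_g$ $(g\in V)$ whose rank-two flats with more than two elements are $A=\{D\}\cup\{a_g:g\in V\}$, $B=\{D\}\cup\{b_g:g\in V\}$, $C=\{D\}\cup\{c_g:g\in V\}$ and $\{a_g,b_{g+h},c_h\}$ $(g,h\in V)$. A *projective rectangle* is a set of points and a set of lines with an incidence relation such that: (A1) every two distinct points are incident with exactly one line; (A2) there are four points, no three of them collinear; (A3) every line has at least three points; (A4) there is a special point $D$ (a line is *special* if it is incident with $D$ and *ordinary* otherwise); (A5) each special line intersects every other line in exactly one point; (A6) if two distinct ordinary lines $l_1,l_2$ intersect in a point, then every two distinct lines that intersect both $l_1$ and $l_2$ in four distinct points intersect in a point. It has *order* $(m,n)$ if there are exactly $m+1$ special lines and one of them has $n+1$ points ($m$, $n$ being cardinal numbers). **Theorem.** Let $L_p^V$ be embedded in a harmonic matroid $M$ (its elements being mapped to points of $M$ with the rank of every set preserved). Put $\mathrm h^\infty(a_g,c_h)=\mathrm h^\infty(\{a_g,b_{g+h},c_h\})$. Let $R_\infty=A$ and, for $0\le t\le p-1$, $R_t=\{D\}\cup\{x_{t,h}:h\in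 V\}$, where $x_{0,h}=b_h$, $x_{1,h}=c_h$, and $x_{t+2,h}$ is the harmonic conjugate of $x_{t,h}$ with respect to $a_0$ and $x_{t+1,h}$. Let $$\mathcal P=\{D\}\cup\bigcup_{g,h\in V}\mathrm h^\infty(a_g,c_h),\qquad \mathcal L=\{R_\infty,R_0,\dots,R_{p-1}\}\cup\{\mathrm h^\infty(a_g,c_h):g,h\in V\},$$ with set membership as incidence. Then $\mathcal P=R_\infty\cup R_0\cup\dots\cup R_{p-1}$, and $(\mathcal P,\mathcal L,\in)$ is a projective rectangle of order $(p,|V|)$ with special point $D$. -/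

import Mathlib

universe u v w

/-! ## Projective rectangles -/

/-- The incidence structure `(P, L, I)` is a projective rectangle with special point `D`.
A line is special if it is incident with `D`, and ordinary otherwise. -/
structure IsProjectiveRectangle {P : Type u} {L : Type v} (I : P → L → Prop) (D : P) : Prop where
  /-- Every two distinct points are incident with exactly one line. -/
  existsUnique_line : ∀ x y : P, x ≠ y → ∃! l : L, I x l ∧ I y l
  /-- There exist four (distinct) points with no three of them collinear. -/
  exists_four : ∃ q : Fin 4 → P, Function.Injective q ∧
    ∀ i j k : Fin 4, i ≠ j → i ≠ k → j ≠ k → ¬ ∃ l : L, I (q i) l ∧ I (q j) l ∧ I (q k) l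
  /-- Every line is incident with at least three distinct points. -/
  three_points : ∀ l : L, ∃ x y z : P, x ≠ y ∧ x ≠ z ∧ y ≠ z ∧ I x l ∧ I y l ∧ I z l
  /-- Each special line intersects every other line in exactly one point. -/
  special_inter : ∀ s l : L, I D s → l ≠ s → ∃! x : P, I x s ∧ I x l
  /-- If two ordinary lines `l₁`, `l₂` intersect in a point, then every two lines `l₃`, `l₄` that
  intersect both `l₁` and `l₂` in four distinct points intersect in a point. -/
  pasch : ∀ l₁ l₂ : L, ¬ I D l₁ → ¬ I D l₂ → l₁ ≠ l₂ → (∃ x : P, I x l₁ ∧ I x l₂) →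
    ∀ l₃ l₄ : L, l₃ ≠ l₄ → ∀ y₁ y₂ y₃ y₄ : P, [y₁, y₂, y₃, y₄].Nodup →
      I y₁ l₁ → I y₁ l₃ → I y₂ l₂ → I y₂ l₃ → I y₃ l₁ → I y₃ l₄ → I y₄ l₂ → I y₄ l₄ →
      ∃! x : P, I x l₃ ∧ I x l₄

/-- The order is `(m, n)`: there are exactly `m + 1` special lines, and one of them has `n + 1`
points. The numbers `m` and `n` are cardinals, possibly infinite. -/
def HasOrder {P : Type u} {L : Type v} (I : P → L → Prop) (D : P) (m n : Cardinal.{w}) : Prop :=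
  Cardinal.lift.{w} (Cardinal.mk {s : L // I D s}) = Cardinal.lift.{v} (m + 1) ∧
    ∃ s : L, I D s ∧
      Cardinal.lift.{w} (Cardinal.mk {x : P // I x s}) = Cardinal.lift.{u} (n + 1)

/-! ## Harmonic conjugation and harmonic matroids -/

section Harmonic

variable {α : Type v}

/-- The points of a matroid: its flats of rank one. (In a simple matroid these are the
singletons of ground elements.) -/
def MPoint (M : Matroid α) : Type v := {F : Set α // M.IsFlat F ∧ M.eRk F = 1}

/-- The rank of a set of points of a matroid. -/
noncomputable def ptRank (M : Matroid α) (S : Set (MPoint M)) : ℕ∞ := M.eRk (⋃ x ∈ S, x.1)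

/-- A set of points is collinear if its rank is at most two. -/
def MCollinear (M : Matroid α) (S : Set (MPoint M)) : Prop := ptRank M S ≤ 2

/-- `HP(d, e, f; a₁, a₂, a₃, a₄)`: the points `d, e, f` are distinct and on a line `l`, the points
`a₁, a₂, a₃, a₄` form a quadrangle (no three of them are collinear) off the line `l`, and the
sides of the quadrangle pass through `d, e, f` as indicated. These conditions force the seven
points to be distinct and allow no collinear triples other than the listed ones and, possibly,
`{a₁, e, a₃}`. -/
structure HarmonicConfig (M : Matroid α) (d e f a₁ a₂ a₃ a₄ : MPoint M) : Prop where
  base_ne : d ≠ e ∧ d ≠ f ∧ e ≠ f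
  base : MCollinear M {d, e, f}
  off_base : ¬ MCollinear M {d, f, a₁} ∧ ¬ MCollinear M {d, f, a₂} ∧
    ¬ MCollinear M {d, f, a₃} ∧ ¬ MCollinear M {d, f, a₄}
  quadrangle : ¬ MCollinear M {a₁, a₂, a₃} ∧ ¬ MCollinear M {a₁, a₂, a₄} ∧
    ¬ MCollinear M {a₁, a₃, a₄} ∧ ¬ MCollinear M {a₂, a₃, a₄}
  d12 : MCollinear M {d, a₁, a₂}
  d43 : MCollinear M {d, a₄, a₃}
  e42 : MCollinear M {e, a₄, a₂}
  f41 : MCollinear M {f, a₄, a₁}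
  f32 : MCollinear M {f, a₃, a₂}

/-- `Hc(d, f; e, h)`: there is a harmonic configuration based on `(d, e, f)`, and `h` is the
harmonic conjugate of `e` with respect to `d` and `f`, i.e. for every harmonic configuration based
on `(d, e, f)` the point `h` is on both lines spanned by `{a₁, a₃}` and by `{d, f}`. -/
def Hc (M : Matroid α) (d f e h : MPoint M) : Prop :=
  (∃ a₁ a₂ a₃ a₄, HarmonicConfig M d e f a₁ a₂ a₃ a₄) ∧
    ∀ a₁ a₂ a₃ a₄, HarmonicConfig M d e f a₁ a₂ a₃ a₄ →
      MCollinear M {a₁, a₃, h} ∧ MCollinear M {d, e, f, h}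

/-- A matroid is harmonic if a harmonic conjugate exists for every harmonic configuration. -/
def IsHarmonic (M : Matroid α) : Prop :=
  ∀ d e f a₁ a₂ a₃ a₄ : MPoint M, HarmonicConfig M d e f a₁ a₂ a₃ a₄ → ∃ h, Hc M d f e h

/-- One step of harmonic closure: add all harmonic conjugates of triples from `S`. -/
def harmonicStep (M : Matroid α) (S : Set (MPoint M)) : Set (MPoint M) :=
  S ∪ {x | ∃ a ∈ S, ∃ b ∈ S, ∃ c ∈ S, Hc M a c b x}

/-- The harmonic closure `h^∞(S)`. -/
def harmonicClosure (M : Matroid α) (S : Set (MPoint M)) : Set (MPoint M) :=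
  ⋃ n : ℕ, (harmonicStep M)^[n] S

end Harmonic

/-! ## The matroid `L_p^V` -/

/-- The elements `D`, `a_g`, `b_g`, `c_g` (`g ∈ V`), all distinct. -/
inductive LPoint (V : Type u) : Type u
  | D : LPoint V
  | a (g : V) : LPoint V
  | b (g : V) : LPoint V
  | c (g : V) : LPoint V

/-- The nontrivial lines of `L_p^V`: `A`, `B`, `C` and all `{a_g, b_{g+h}, c_h}`. -/
def lpLines (V : Type u) [AddCommGroup V] : Set (Set (LPoint V)) :=
  {insert LPoint.D (Set.range LPoint.a), insert LPoint.D (Set.range LPoint.b),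
    insert LPoint.D (Set.range LPoint.c)} ∪
  {l | ∃ g h : V, l = {LPoint.a g, LPoint.b (g + h), LPoint.c h}}

theorem lpLines_unique {V : Type u} [AddCommGroup V] {l l' : Set (LPoint V)}
    (hl : l ∈ lpLines V) (hl' : l' ∈ lpLines V) {x y : LPoint V} (hxy : x ≠ y)
    (hx : x ∈ l) (hy : y ∈ l) (hx' : x ∈ l') (hy' : y ∈ l') : l = l' := by
  rcases hl with (rfl | rfl | rfl) | ⟨g, h, rfl⟩ <;>
  rcases hl' with (rfl | rfl | rfl) | ⟨g', h', rfl⟩ <;>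
  cases x <;> cases y <;> simp_all

/-- The simple matroid of rank three on `{D} ∪ {a_g, b_g, c_g : g ∈ V}` whose rank-two flats with
more than two elements are given by `lpLines V`: a set is independent if it has at most three
elements and is not a triple contained in one of these lines. -/
def lpMatroid (V : Type u) [AddCommGroup V] : Matroid (LPoint V) :=
  (IndepMatroid.ofBddAugment Set.univ
    (fun I => I.encard ≤ 3 ∧ ∀ l ∈ lpLines V, I ⊆ l → I.encard ≤ 2)
    (by simp)
    (by
      intro I J hJ hIJ
      refine ⟨(Set.encard_le_encard hIJ).trans hJ.1, ?_⟩
      intro l hl hIl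
      by_contra hc
      have h3 : 3 ≤ I.encard := by
        have := Order.add_one_le_of_lt (not_le.1 hc)
        simpa [show (2 : ℕ∞) + 1 = 3 from rfl] using this
      have hfin : J.Finite := Set.finite_of_encard_le_coe (k := 3) hJ.1
      have hEq : I = J :=
        Set.Finite.eq_of_subset_of_encard_le (hfin.subset hIJ) hIJ (hJ.1.trans h3)
      subst hEq
      exact hc (hJ.2 l hl hIl))
    (by
      intro I J hI hJ hlt
      have hne : ∃ e ∈ J, e ∉ I := by
        by_contra! hsub
        exact absurd (Set.encard_le_encard hsub) (not_le.2 hlt)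
      by_contra! hfail
      have hI2 : I.encard ≤ 2 := by
        have h3 : I.encard < 3 := lt_of_lt_of_le hlt hJ.1
        exact Order.le_of_lt_add_one (by simpa [show (2 : ℕ∞) + 1 = 3 from rfl] using h3)
      have key : ∀ e ∈ J, e ∉ I → ∃ l ∈ lpLines V, insert e I ⊆ l ∧ ¬ (insert e I).encard ≤ 2 := by
        intro e he heI
        have hc : (insert e I).encard ≤ 3 := by
          rw [Set.encard_insert_of_notMem heI]
          calc I.encard + 1 ≤ 2 + 1 := by gcongr
            _ = 3 := rfl
        obtain ⟨l, hl, hsub, hlt'⟩ := hfail e he heI hc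
        exact ⟨l, hl, hsub, not_le.2 hlt'⟩
      obtain ⟨e, heJ, heI⟩ := hne
      obtain ⟨l, hl, hsub, hbig⟩ := key e heJ heI
      have hI1 : 1 < I.encard := by
        by_contra hc
        apply hbig
        rw [Set.encard_insert_of_notMem heI]
        calc I.encard + 1 ≤ 1 + 1 := by gcongr; exact not_lt.1 hc
          _ = 2 := rfl
      obtain ⟨x, y, hx, hy, hxy⟩ := Set.one_lt_encard_iff.1 hI1
      have hJl : J ⊆ l := by
        intro e' he'
        by_cases heI' : e' ∈ I
        · exact hsub (Set.mem_insert_of_mem _ heI')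
        · obtain ⟨l', hl', hsub', -⟩ := key e' he' heI'
          have := lpLines_unique hl hl' hxy (hsub (Set.mem_insert_of_mem _ hx))
            (hsub (Set.mem_insert_of_mem _ hy)) (hsub' (Set.mem_insert_of_mem _ hx))
            (hsub' (Set.mem_insert_of_mem _ hy))
          rw [this]
          exact hsub' (Set.mem_insert _ _)
      have h2 := hJ.2 l hl hJl
      have h3 : I.encard + 1 ≤ 2 := (Order.add_one_le_of_lt hlt).trans h2
      have h4 : (1 : ℕ∞) + 1 ≤ I.encard := Order.add_one_le_of_lt hI1
      have h5 : (1 : ℕ∞) + 1 + 1 ≤ 2 := (add_le_add_left h4 1).trans h3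
      exact absurd h5 (by decide))
    ⟨3, fun I hI => hI.1⟩
    (fun I _ => Set.subset_univ I)).matroid

/-! ## The construction in a harmonic matroid -/

section Construction

variable {V : Type u} [AddCommGroup V] {α : Type v} {M : Matroid α}

/-- `φ` embeds `L_p^V` in `M`: it maps the elements of `L_p^V` to points of `M` and preserves the
rank of every set. -/
def IsLpEmbedding (M : Matroid α) (φ : LPoint V → MPoint M) : Prop :=
  ∀ S : Set (LPoint V), ptRank M (φ '' S) = (lpMatroid V).eRk S

/-- `IsRowPoint φ t h x` says that `x` is the point `x_{t,h}` of the row `R_t`. The first two rows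
are given by `x_{0,h} = b_h` and `x_{1,h} = c_h`, and `x_{t+2,h}` is the harmonic conjugate of
`x_{t,h}` with respect to `a_0` and `x_{t+1,h}`. -/
inductive IsRowPoint (φ : LPoint V → MPoint M) : ℕ → V → MPoint M → Prop
  | zero (h : V) : IsRowPoint φ 0 h (φ (.b h))
  | one (h : V) : IsRowPoint φ 1 h (φ (.c h))
  | step {t : ℕ} {h : V} {x y z : MPoint M} : IsRowPoint φ t h x → IsRowPoint φ (t + 1) h y →
      Hc M (φ (.a 0)) y x z → IsRowPoint φ (t + 2) h z

/-- `R_∞ = A = {D} ∪ {a_g : g ∈ V}`. -/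
def rowInfty (φ : LPoint V → MPoint M) : Set (MPoint M) :=
  insert (φ .D) (Set.range fun g => φ (.a g))

/-- `R_t = {D} ∪ {x_{t,h} : h ∈ V}`. -/
def row (φ : LPoint V → MPoint M) (t : ℕ) : Set (MPoint M) :=
  insert (φ .D) {x | ∃ h : V, IsRowPoint φ t h x}

/-- `h^∞(a_g, c_h)`, the harmonic closure of `{a_g, b_{g+h}, c_h}`. -/
def ordLine (φ : LPoint V → MPoint M) (g h : V) : Set (MPoint M) :=
  harmonicClosure M {φ (.a g), φ (.b (g + h)), φ (.c h)}

/-- The point set: `D` and the points of all `h^∞(a_g, c_h)`. -/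
def prPoints (φ : LPoint V → MPoint M) : Set (MPoint M) :=
  insert (φ .D) (⋃ (g : V) (h : V), ordLine φ g h)

/-- The line set: `R_∞, R_0, …, R_{p-1}` and all `h^∞(a_g, c_h)`. -/
def prLines (p : ℕ) (φ : LPoint V → MPoint M) : Set (Set (MPoint M)) :=
  {rowInfty φ} ∪ {l | ∃ t < p, l = row φ t} ∪ {l | ∃ g h : V, l = ordLine φ g h}

/-- The incidence relation: set membership. -/
def prInc (p : ℕ) (φ : LPoint V → MPoint M) (x : prPoints φ) (l : prLines p φ) : Prop :=
  x.1 ∈ l.1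

/-- The point `D` of the system. -/
def prD (φ : LPoint V → MPoint M) : prPoints φ := ⟨φ .D, Set.mem_insert _ _⟩

end Construction

/-! The uniqueness of harmonic conjugates lets three rows of points through `D` generate all the
others. If `(a, b, c)` is a labelled copy of `L_p^V` and `z h` is the conjugate of `b h` with
respect to `a 0` and `c h`, then `(a, c, z)` is again a copy (`LpFrame.exists_next`): the
quadrangles with vertex `D` place `z h` on every line `a g`, `c (g + h)`, and a second quadrangle
places all `z h` on one line through `D`. Iteration yields rows `x t`, and the ordinary line through
`a g` and `x 0 k` meets row `t` in `x t (k - t • g)` (`LpFrame.coll_add`). In characteristic `p`,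
the rows `0, ..., p - 1` lie on distinct lines through `D` (`LpFrame.not_coll_rows`).

Thus the points `D`, `a g`, `x t h` with `t < p` form a copy of a coordinate rectangle over `ZMod
p`: the pair `(g, k)` stands for the ordinary line with value `g` on row `∞` and `k - t • g` on row
`t`. Its axioms are linear algebra, the Pasch axiom being `exists_rowVal_eq`. That same property
provides inside the rectangle a harmonic configuration for any three points of an ordinary line,
together with the meeting point of its diagonal with that line. Hence the `p + 1` points of the line
are closed under conjugation, and they are exactly its harmonic closure (`ordLine_eq_range`). The
periodicity of the rows modulo `p` never has to be proved separately. -/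

/-! ### Collinearity of matroid points and uniqueness of harmonic conjugates. -/

section Collinear

variable {α : Type v} {M : Matroid α}

/-- Collinearity of three points of a matroid. -/
def Coll (M : Matroid α) (x y z : MPoint M) : Prop := MCollinear M {x, y, z}

theorem ptRank_triple (x y z : MPoint M) : ptRank M {x, y, z} = M.eRk (x.1 ∪ (y.1 ∪ z.1)) := by
  simp [ptRank]

theorem coll_iff {x y z : MPoint M} : Coll M x y z ↔ M.eRk (x.1 ∪ (y.1 ∪ z.1)) ≤ 2 := by
  rw [Coll, MCollinear, ptRank_triple]

theorem Coll.swap_left {x y z : MPoint M} (h : Coll M x y z) : Coll M y x z := by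
  rw [coll_iff] at *
  rwa [Set.union_left_comm]

theorem Coll.swap_right {x y z : MPoint M} (h : Coll M x y z) : Coll M x z y := by
  rw [coll_iff] at *
  rwa [Set.union_comm z.1]

theorem Coll.rotate {x y z : MPoint M} (h : Coll M x y z) : Coll M y z x :=
  h.swap_left.swap_right

theorem MPoint.eRk_union_le (x y : MPoint M) : M.eRk (x.1 ∪ y.1) ≤ 2 := by
  refine (M.eRk_union_le_eRk_add_eRk _ _).trans ?_
  rw [x.2.2, y.2.2]
  rfl

theorem MPoint.eq_of_subset {x y : MPoint M} (h : x.1 ⊆ y.1) : x = y := by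
  have hx : M.IsRkFinite x.1 := by rw [← Matroid.eRk_ne_top_iff, x.2.2]; simp
  have := hx.closure_eq_closure_of_subset_of_eRk_ge_eRk h (by rw [x.2.2, y.2.2])
  rw [x.2.1.closure, y.2.1.closure] at this
  exact Subtype.ext this

theorem MPoint.two_le_eRk_union {x y : MPoint M} (h : x ≠ y) : 2 ≤ M.eRk (x.1 ∪ y.1) := by
  by_contra hlt
  have h1 : M.eRk (x.1 ∪ y.1) ≤ 1 := by
    refine Order.le_of_lt_add_one ?_
    simpa [show (1 : ℕ∞) + 1 = 2 from rfl] using hlt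
  have hy : M.IsRkFinite y.1 := by rw [← Matroid.eRk_ne_top_iff, y.2.2]; simp
  have := hy.closure_eq_closure_of_subset_of_eRk_ge_eRk (Set.subset_union_right (s := x.1))
    (by rw [y.2.2]; exact h1)
  rw [y.2.1.closure] at this
  apply h
  apply MPoint.eq_of_subset
  rw [this]
  exact Set.subset_union_left.trans
    (M.subset_closure _ (Set.union_subset x.2.1.subset_ground y.2.1.subset_ground))

/-- Two distinct points already have rank two, so a third one that keeps the rank at two lies in
their closure. -/
theorem coll_iff_subset_closure {x y z : MPoint M} (h : x ≠ y) :
    Coll M x y z ↔ z.1 ⊆ M.closure (x.1 ∪ y.1) := by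
  have hE : x.1 ∪ (y.1 ∪ z.1) ⊆ M.E := Set.union_subset x.2.1.subset_ground
    (Set.union_subset y.2.1.subset_ground z.2.1.subset_ground)
  have hsub : x.1 ∪ y.1 ⊆ x.1 ∪ (y.1 ∪ z.1) := by grind
  rw [coll_iff]
  constructor
  · intro hc
    have hfin : M.IsRkFinite (x.1 ∪ y.1) := by
      rw [← Matroid.eRk_ne_top_iff]
      exact ne_top_of_le_ne_top (by simp) (MPoint.eRk_union_le x y)
    rw [hfin.closure_eq_closure_of_subset_of_eRk_ge_eRk hsub (hc.trans (MPoint.two_le_eRk_union h))]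
    exact Set.Subset.trans (by grind) (M.subset_closure _ hE)
  · intro hz
    refine le_trans (M.eRk_mono (?_ : _ ≤ M.closure (x.1 ∪ y.1))) ?_
    · have := M.subset_closure (x.1 ∪ y.1) (hsub.trans hE)
      exact Set.union_subset (by grind) (Set.union_subset (by grind) hz)
    · rw [M.eRk_closure_eq]
      exact MPoint.eRk_union_le x y

/-- All later incidence arguments rest on this lemma instead of ranks: everything on the line
through `x` and `y` lies in one closure of rank two. -/
theorem coll_of_coll {x y a b c : MPoint M} (h : x ≠ y) (ha : Coll M x y a) (hb : Coll M x y b)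
    (hc : Coll M x y c) : Coll M a b c := by
  rw [coll_iff_subset_closure h] at ha hb hc
  rw [coll_iff]
  refine (M.eRk_mono (Set.union_subset ha (Set.union_subset hb hc))).trans ?_
  rw [M.eRk_closure_eq]
  exact MPoint.eRk_union_le x y

theorem coll_self_left (x y : MPoint M) : Coll M x x y := by
  rw [coll_iff, ← Set.union_assoc, Set.union_self]
  exact MPoint.eRk_union_le x y

theorem coll_self_right (x y : MPoint M) : Coll M x y y := (coll_self_left y x).rotate.rotate

theorem coll_self_outer (x y : MPoint M) : Coll M x y x := (coll_self_left x y).swap_right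

/-- Points collinear with two distinct points may replace one of them. -/
theorem Coll.trans {x y z w : MPoint M} (h : x ≠ y) (hz : Coll M x y z) (hw : Coll M x y w) :
    Coll M x z w :=
  coll_of_coll h (coll_self_outer x y) hz hw

/-- Two lines with two distinct common points are equal. -/
theorem eq_of_coll {x y z w : MPoint M} (h : ¬ Coll M x y z) (hzw : Coll M x y w)
    (hw : Coll M x z w) : w = x := by
  by_contra hne
  exact h (coll_of_coll hne (coll_self_right _ _) hzw.rotate.rotate hw.rotate.rotate)

theorem ne_of_not_coll {x y z : MPoint M} (h : ¬ Coll M x y z) : x ≠ y ∧ x ≠ z ∧ y ≠ z :=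
  ⟨fun e => h (e ▸ coll_self_left _ _), fun e => h (e ▸ coll_self_outer _ _),
    fun e => h (e ▸ coll_self_right _ _)⟩

/-- A harmonic conjugate is on both lines determined by each harmonic configuration. -/
theorem Hc.coll {d f e h a₁ a₂ a₃ a₄ : MPoint M} (hh : Hc M d f e h)
    (hc : HarmonicConfig M d e f a₁ a₂ a₃ a₄) : Coll M a₁ a₃ h ∧ Coll M d f h := by
  obtain ⟨h1, h2⟩ := hh.2 _ _ _ _ hc
  refine ⟨h1, le_trans (M.eRk_mono ?_) h2⟩
  exact Set.biUnion_subset_biUnion_left (by grind)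

/-- The diagonal `a₁a₃` and the base line are distinct because `a₁` is off the base, so they share
at most one point. A single configuration therefore identifies the conjugate. -/
theorem HarmonicConfig.eq_of_coll {d e f a₁ a₂ a₃ a₄ x y : MPoint M}
    (hc : HarmonicConfig M d e f a₁ a₂ a₃ a₄) (hx : Coll M a₁ a₃ x) (hx' : Coll M d f x)
    (hy : Coll M a₁ a₃ y) (hy' : Coll M d f y) : x = y := by
  by_contra hne
  have h13 : a₁ ≠ a₃ := (ne_of_not_coll (M := M) hc.quadrangle.1).2.1
  have hdf := hc.base_ne.2.1
  have h1 : Coll M x y a₁ := coll_of_coll h13 hx hy (coll_self_outer _ _)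
  have hd : Coll M x y d := coll_of_coll hdf hx' hy' (coll_self_outer _ _)
  have hf : Coll M x y f := coll_of_coll hdf hx' hy' (coll_self_right _ _)
  exact hc.off_base.1 (coll_of_coll hne hd hf h1)

theorem Hc.unique {d f e x y : MPoint M} (hx : Hc M d f e x) (hy : Hc M d f e y) : x = y := by
  obtain ⟨a₁, a₂, a₃, a₄, hc⟩ := hx.1
  exact hc.eq_of_coll (hx.coll hc).1 (hx.coll hc).2 (hy.coll hc).1 (hy.coll hc).2

theorem HarmonicConfig.hc_of_coll (hM : IsHarmonic M) {d e f a₁ a₂ a₃ a₄ x : MPoint M}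
    (hc : HarmonicConfig M d e f a₁ a₂ a₃ a₄) (hx : Coll M a₁ a₃ x) (hx' : Coll M d f x) :
    Hc M d f e x := by
  obtain ⟨h, hh⟩ := hM _ _ _ _ _ _ _ hc
  rwa [hc.eq_of_coll hx hx' (hh.coll hc).1 (hh.coll hc).2]

/-- If the diagonal `a₁a₃` passed through `d` or `f`, it would contain `a₂` or `a₄`. This keeps each
new row apart from the rows that produce it. -/
theorem Hc.ne {d f e h : MPoint M} (hh : Hc M d f e h) : h ≠ d ∧ h ≠ f := by
  obtain ⟨a₁, a₂, a₃, a₄, hc⟩ := hh.1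
  obtain ⟨h1, h2⟩ := hh.coll hc
  have q := hc.quadrangle
  constructor <;> rintro rfl
  · have hne : h ≠ a₁ := by
      rintro rfl
      exact hc.off_base.1 (coll_self_outer (M := M) _ _)
    exact q.1 (coll_of_coll hne (coll_self_right _ _) hc.d12 h1.rotate.rotate)
  · have hne : h ≠ a₁ := by
      rintro rfl
      exact hc.off_base.1 (coll_self_right (M := M) _ _)
    exact q.2.2.1 (coll_of_coll hne (coll_self_right _ _) h1.rotate.rotate (Coll.swap_right hc.f41))

end Collinear

/-! ### Collinear triples of the embedded `L_p^V`. -/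

section Embedding

variable {V : Type u} [AddCommGroup V] {α : Type v} {M : Matroid α} {φ : LPoint V → MPoint M}

theorem lpMatroid_indep_iff {I : Set (LPoint V)} : (lpMatroid V).Indep I ↔
    I.encard ≤ 3 ∧ ∀ l ∈ lpLines V, I ⊆ l → I.encard ≤ 2 := Iff.rfl

theorem IsLpEmbedding.coll (hφ : IsLpEmbedding M φ) {x y z : LPoint V} {l : Set (LPoint V)}
    (hl : l ∈ lpLines V) (hx : x ∈ l) (hy : y ∈ l) (hz : z ∈ l) :
    Coll M (φ x) (φ y) (φ z) := by
  have := hφ {x, y, z}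
  rw [Set.image_insert_eq, Set.image_pair] at this
  rw [Coll, MCollinear, this, Matroid.eRk_le_iff]
  intro I hI hInd
  exact (lpMatroid_indep_iff.1 hInd).2 l hl (hI.trans (by grind))

theorem IsLpEmbedding.not_coll (hφ : IsLpEmbedding M φ) {x y z : LPoint V}
    (hxy : x ≠ y) (hxz : x ≠ z) (hyz : y ≠ z)
    (h : ∀ l ∈ lpLines V, x ∈ l → y ∈ l → z ∉ l) : ¬ Coll M (φ x) (φ y) (φ z) := by
  have := hφ {x, y, z}
  rw [Set.image_insert_eq, Set.image_pair] at this
  have h3 : ({x, y, z} : Set (LPoint V)).encard = 3 := Set.encard_eq_three.2 ⟨x, y, z, hxy, hxz, hyz, rfl⟩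
  have hI : (lpMatroid V).Indep {x, y, z} := lpMatroid_indep_iff.2
    ⟨h3.le, fun l hl hsub => (h l hl (hsub (by simp)) (hsub (by simp)) (hsub (by simp))).elim⟩
  rw [Coll, MCollinear, this, hI.eRk_eq_encard, h3]
  decide

theorem IsLpEmbedding.injective (hφ : IsLpEmbedding M φ) : Function.Injective φ := by
  intro x y hxy
  by_contra hne
  have := hφ {x, y}
  have h2 : ({x, y} : Set (LPoint V)).encard = 2 := Set.encard_pair hne
  have hI : (lpMatroid V).Indep {x, y} := lpMatroid_indep_iff.2
    ⟨h2.le.trans (by decide), fun l hl hsub => h2.le⟩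
  rw [Set.image_pair, hxy, Set.pair_eq_singleton, hI.eRk_eq_encard, h2] at this
  have h1 : ptRank M {φ y} = 1 := by simp [ptRank, (φ y).2.2]
  rw [h1] at this
  exact absurd this (by decide)

end Embedding

/-! ### Producing a new row from two old ones by harmonic conjugation. -/

section Frame

variable {V : Type u} [AddCommGroup V] {α : Type v} {M : Matroid α}

/-- A labelled copy of `L_p^V` among the points of `M`, described by collinear triples. -/
structure LpFrame (M : Matroid α) (D : MPoint M) (a b c : V → MPoint M) : Prop where
  aa : ∀ g g', Coll M D (a g) (a g')
  bb : ∀ g g', Coll M D (b g) (b g')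
  cc : ∀ g g', Coll M D (c g) (c g')
  abc : ∀ g h, Coll M (a g) (b (g + h)) (c h)
  a_inj : Function.Injective a
  b_inj : Function.Injective b
  c_inj : Function.Injective c
  ab : ∀ g h, ¬ Coll M D (a g) (b h)
  ac : ∀ g h, ¬ Coll M D (a g) (c h)
  bc : ∀ g h, ¬ Coll M D (b g) (c h)

theorem IsLpEmbedding.frame {φ : LPoint V → MPoint M} (hφ : IsLpEmbedding M φ) :
    LpFrame M (φ .D) (fun g => φ (.a g)) (fun g => φ (.b g)) (fun g => φ (.c g)) where
  aa g g' := hφ.coll (l := insert LPoint.D (Set.range LPoint.a)) (by simp [lpLines])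
    (by simp) (by simp) (by simp)
  bb g g' := hφ.coll (l := insert LPoint.D (Set.range LPoint.b)) (by simp [lpLines])
    (by simp) (by simp) (by simp)
  cc g g' := hφ.coll (l := insert LPoint.D (Set.range LPoint.c)) (by simp [lpLines])
    (by simp) (by simp) (by simp)
  abc g h := hφ.coll (l := {LPoint.a g, LPoint.b (g + h), LPoint.c h})
    (.inr ⟨g, h, rfl⟩) (by simp) (by simp) (by simp)
  a_inj g g' h := by simpa using hφ.injective h
  b_inj g g' h := by simpa using hφ.injective h
  c_inj g g' h := by simpa using hφ.injective h
  ab g h := hφ.not_coll (by simp) (by simp) (by simp) (by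
    rintro l ((rfl | rfl | rfl) | ⟨g', h', rfl⟩) <;> simp)
  ac g h := hφ.not_coll (by simp) (by simp) (by simp) (by
    rintro l ((rfl | rfl | rfl) | ⟨g', h', rfl⟩) <;> simp)
  bc g h := hφ.not_coll (by simp) (by simp) (by simp) (by
    rintro l ((rfl | rfl | rfl) | ⟨g', h', rfl⟩) <;> simp)

/-- Two points of a line through `D` are not collinear with a point off that line. -/
theorem not_coll_of_not_coll {D x y z : MPoint M} (hxy : x ≠ y) (h : Coll M D x y)
    (hz : ¬ Coll M D x z) : ¬ Coll M x y z := fun hc =>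
  hz (coll_of_coll hxy h.rotate (coll_self_outer _ _) hc)

namespace LpFrame

variable {D : MPoint M} {a b c z : V → MPoint M}

/-- The base does not depend on `k`, while the diagonal joins `a (g + k)` to `c (h + k)`. So one
conjugate lies on all these diagonals at once. -/
theorem config (F : LpFrame M D a b c) (g h : V) {k : V} (hk : k ≠ 0) :
    HarmonicConfig M (a g) (b (g + h)) (c h) (a (g + k)) D (c (h + k)) (b (g + h + k)) := by
  have na : a g ≠ a (g + k) := fun e => hk (by simpa using F.a_inj e)
  have nb : b (g + h) ≠ b (g + h + k) := fun e => hk (by simpa using F.b_inj e)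
  have nc : c h ≠ c (h + k) := fun e => hk (by simpa using F.c_inj e)
  refine ⟨⟨(ne_of_not_coll (F.ab g (g + h))).2.2, (ne_of_not_coll (F.ac g h)).2.2,
    (ne_of_not_coll (F.bc (g + h) h)).2.2⟩, F.abc g h, ⟨?_, ?_, ?_, ?_⟩, ⟨?_, ?_, ?_, ?_⟩,
    ?_, ?_, ?_, ?_, ?_⟩
  · exact fun hc => not_coll_of_not_coll na (F.aa _ _) (F.ac g h) (Coll.swap_right hc)
  · exact fun hc => F.ac g h (Coll.rotate hc).rotate
  · exact fun hc => not_coll_of_not_coll nc (F.cc _ _) (fun hc' => F.ac g h hc'.swap_right)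
      (Coll.rotate hc)
  · intro hc
    have hac := (ne_of_not_coll (F.ac g h)).2.2
    exact not_coll_of_not_coll nb (F.bb _ _) (fun hc' => F.bc (g + h) h hc')
      (coll_of_coll hac (F.abc g h).swap_right hc (coll_self_right _ _))
  · exact fun hc => F.ac (g + k) (h + k) (Coll.swap_left hc)
  · exact fun hc => F.ab (g + k) (g + h + k) (Coll.swap_left hc)
  · intro hc
    have hab := (ne_of_not_coll (F.ab (g + k) (g + h + k))).2.2
    have h1 := F.abc (g + k) h
    rw [add_right_comm] at h1
    exact not_coll_of_not_coll nc (F.cc _ _) (fun hc' => F.ac (g + k) h hc'.swap_right)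
      (coll_of_coll hab h1 (Coll.swap_right hc) (coll_self_outer _ _))
  · exact fun hc => F.bc (g + h + k) (h + k) (Coll.swap_right hc)
  · exact (F.aa g (g + k)).rotate
  · have := F.abc g (h + k)
    rwa [← add_assoc] at this
  · exact (F.bb _ _).rotate
  · have := F.abc (g + k) h
    rw [add_right_comm] at this
    exact this.rotate.rotate.swap_right
  · exact (F.cc _ _).rotate

/-- Consecutive frames are related by harmonic conjugation on all lines. -/
theorem hc [Nontrivial V] (hM : IsHarmonic M) (F : LpFrame M D a b c) (F' : LpFrame M D a c z)
    (g h : V) : Hc M (a g) (c h) (b (g + h)) (z (h - g)) := by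
  obtain ⟨k, hk⟩ := exists_ne (0 : V)
  refine (F.config g h hk).hc_of_coll hM ?_ ?_
  · have := F'.abc (g + k) (h - g)
    rwa [show g + k + (h - g) = h + k by abel] at this
  · have := F'.abc g (h - g)
    rwa [show g + (h - g) = h by abel] at this

/-- The new row is defined on the lines through `a 0` only; independence of the conjugate from the
quadrangle carries it to all slopes. -/
theorem exists_next [Nontrivial V] (hM : IsHarmonic M) (F : LpFrame M D a b c) :
    ∃ z : V → MPoint M, LpFrame M D a c z := by
  have hex : ∀ h, ∃ z, Hc M (a 0) (c h) (b h) z := by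
    intro h
    obtain ⟨k, hk⟩ := exists_ne (0 : V)
    have := F.config 0 h hk
    simp only [zero_add] at this
    exact hM _ _ _ _ _ _ _ this
  choose z hz using hex
  have line : ∀ g h, Coll M (a g) (c (g + h)) (z h) := by
    intro g h
    rcases eq_or_ne g 0 with rfl | hg
    -- For slope zero the line is the base of the configuration; for slope `g ≠ 0` it is the
    -- diagonal of the configuration shifted by `g`.
    · obtain ⟨k, hk⟩ := exists_ne (0 : V)
      have := F.config 0 h hk
      simp only [zero_add] at this ⊢
      exact ((hz h).coll this).2
    · have := F.config 0 h hg
      simp only [zero_add] at this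
      rw [add_comm g h]
      exact ((hz h).coll this).1
  have line0 : ∀ h, Coll M (a 0) (c h) (z h) := fun h => by simpa using line 0 h
  have a0cc : ∀ g {h h'}, h ≠ h' → ¬ Coll M (a g) (c h) (c h') := fun g h h' hne hc =>
    not_coll_of_not_coll (fun e => hne (F.c_inj e)) (F.cc h h') (fun hc' => F.ac g h hc'.swap_right)
      hc.rotate
  -- A point `z h` on the line of the `a g` would be `a 0`, where that line meets the base; likewise
  -- `cz` would force `z h = c h`. Both are excluded by `Hc.ne`.
  have az : ∀ g h, ¬ Coll M D (a g) (z h) := by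
    intro g h hc
    have h1 : Coll M D (a 0) (z h) :=
      coll_of_coll (ne_of_not_coll (F.ab g 0)).1 (coll_self_outer _ _) (F.aa g 0) hc
    exact (hz h).ne.1 (eq_of_coll (fun h2 => F.ac 0 h h2.swap_left) h1.swap_left (line0 h))
  have cz : ∀ g h, ¬ Coll M D (c g) (z h) := by
    intro g h hc
    have h1 : Coll M D (c h) (z h) :=
      coll_of_coll (ne_of_not_coll (F.bc 0 g)).2.1 (coll_self_outer _ _) (F.cc g h) hc
    exact (hz h).ne.2 (eq_of_coll (fun h2 => F.ac 0 h h2.rotate) h1.swap_left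
      (line0 h).swap_left)
  have zz : ∀ g k, g ≠ 0 → Coll M D (z k) (z (g + k)) := by
    intro g k hg
    have hgk : g + k ≠ k := by simpa using hg
    have base := F.abc 0 (g + k)
    have na : a 0 ≠ a g := fun e => hg (F.a_inj e).symm
    have nc : c (g + k) ≠ c k := fun e => hgk (F.c_inj e)
    rw [zero_add] at base
    -- This quadrangle uses the new point `z k`. Its base is the one that defines `z (g + k)`, and
    -- its diagonal is the line through `z k` and `D`.
    have hC : HarmonicConfig M (a 0) (b (g + k)) (c (g + k)) (z k) (c k) D (a g) := by
      refine ⟨⟨(ne_of_not_coll (F.ab 0 (g + k))).2.2, (ne_of_not_coll (F.ac 0 (g + k))).2.2,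
        (ne_of_not_coll (F.bc (g + k) (g + k))).2.2⟩, base, ⟨?_, ?_, ?_, ?_⟩, ⟨?_, ?_, ?_, ?_⟩,
        (line0 k).swap_right, (F.aa 0 g).rotate, ?_, (line g k).swap_left,
        (F.cc (g + k) k).swap_left⟩
      · exact fun hc => (hz k).ne.1 (eq_of_coll (a0cc 0 hgk) hc (line0 k))
      · exact a0cc 0 hgk
      · exact fun hc => F.ac 0 (g + k) (Coll.rotate hc).rotate
      · exact fun hc => not_coll_of_not_coll na (F.aa _ _) (F.ac 0 (g + k)) (Coll.swap_right hc)
      · exact fun hc => cz k k (Coll.rotate hc).swap_left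
      · intro hc
        exact (ne_of_not_coll (az g k)).2.2.symm
          (eq_of_coll (a0cc g hgk) (line g k) (Coll.rotate hc).rotate.swap_right)
      · exact fun hc => az g k (Coll.rotate hc)
      · exact fun hc => F.ac g k (Coll.swap_right (Coll.swap_left hc))
      · exact (F.abc g k).swap_left
    exact (((hz (g + k)).coll hC).1).swap_left
  refine ⟨z, F.aa, F.cc, ?_, line, F.a_inj, F.c_inj, ?_, F.ac, az, cz⟩
  · intro k k'
    rcases eq_or_ne k' k with rfl | hne
    · exact coll_self_right _ _
    · simpa using zz (k' - k) k (sub_ne_zero.2 hne)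
  · intro h h' e
    by_contra hne
    have h1 := line0 h'
    rw [← e] at h1
    exact (hz h).ne.1 (eq_of_coll (a0cc 0 hne) (line0 h) h1)

/-- Iterated harmonic conjugation gives rows indexed by the natural numbers. -/
theorem exists_rows [Nontrivial V] (hM : IsHarmonic M) (F : LpFrame M D a b c) :
    ∃ x : ℕ → V → MPoint M, x 0 = b ∧ x 1 = c ∧ ∀ t, LpFrame M D a (x t) (x (t + 1)) := by
  let T := {q : (V → MPoint M) × (V → MPoint M) // LpFrame M D a q.1 q.2}
  choose next hnext using fun q : T => q.2.exists_next hM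
  let s : ℕ → T := fun t => Nat.rec ⟨(b, c), F⟩ (fun _ q => ⟨(q.1.2, next q), hnext q⟩) t
  exact ⟨fun t => (s t).1.1, rfl, rfl, fun t => (s t).2⟩

end LpFrame

end Frame

/-! ### The coordinate rectangle over `ZMod p`. -/

section CoordinateRectangle

variable (p : ℕ) (V : Type u)

/-- Points of the coordinate model: `D` and the pairs of a row index and a value. -/
abbrev RectPoint := Option (Option (ZMod p) × V)

/-- Lines of the coordinate model: the rows, and the ordinary lines `(g, k)` with slope `g`. -/
abbrev RectLine := Option (ZMod p) ⊕ (V × V)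

variable {p V} [AddCommGroup V] [Module (ZMod p) V]

/-- The value of an ordinary line on a row. -/
def rowVal : Option (ZMod p) → V × V →ₗ[ZMod p] V
  | none => LinearMap.fst _ _ _
  | some t => LinearMap.snd _ _ _ - t • LinearMap.fst _ _ _

@[simp] theorem rowVal_none (q : V × V) : rowVal (p := p) none q = q.1 := rfl

@[simp] theorem rowVal_some (t : ZMod p) (q : V × V) : rowVal (some t) q = q.2 - t • q.1 := rfl

/-- Incidence of the coordinate model. -/
def rectInc : RectPoint p V → RectLine p V → Prop
  | none, .inl _ => True
  | none, .inr _ => False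
  | some (r, _), .inl s => r = s
  | some (r, v), .inr q => v = rowVal r q

@[simp] theorem rectInc_none_inl (s : Option (ZMod p)) :
    rectInc (none : RectPoint p V) (.inl s) ↔ True := Iff.rfl

@[simp] theorem rectInc_none_inr (q : V × V) :
    rectInc (none : RectPoint p V) (.inr q) ↔ False := Iff.rfl

@[simp] theorem rectInc_some_inl (r s : Option (ZMod p)) (v : V) :
    rectInc (some (r, v)) (.inl s) ↔ r = s := Iff.rfl

@[simp] theorem rectInc_some_inr (r : Option (ZMod p)) (v : V) (q : V × V) :
    rectInc (some (r, v)) (.inr q) ↔ v = rowVal r q := Iff.rfl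

variable [Fact p.Prime]

/-- Two distinct rows give an invertible linear system in the coordinates of `q`. The case `S = ⊥`
yields uniqueness of lines; a span of one vector yields the Pasch property. -/
theorem mem_of_rowVal_mem {S : Submodule (ZMod p) V} {r s : Option (ZMod p)} (h : r ≠ s)
    {q : V × V} (hr : rowVal r q ∈ S) (hs : rowVal s q ∈ S) : q.1 ∈ S ∧ q.2 ∈ S := by
  have aux : ∀ t : ZMod p, q.1 ∈ S → q.2 - t • q.1 ∈ S → q.2 ∈ S := fun t h1 h2 => by
    simpa using S.add_mem h2 (S.smul_mem t h1)
  rcases r with _ | r <;> rcases s with _ | s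
  · exact (h rfl).elim
  · exact ⟨hr, aux s hr hs⟩
  · exact ⟨hs, aux r hs hr⟩
  · have hne : s - r ≠ 0 := sub_ne_zero.2 fun e => h (by rw [e])
    have h1 : q.1 ∈ S := by
      have := S.smul_mem (s - r)⁻¹ (S.sub_mem hr hs)
      rwa [rowVal_some, rowVal_some, sub_sub_sub_cancel_left, ← sub_smul, smul_smul,
        inv_mul_cancel₀ hne, one_smul] at this
    exact ⟨h1, aux r h1 hr⟩

theorem rowVal_mem {S : Submodule (ZMod p) V} (r : Option (ZMod p)) {q : V × V}
    (h : q.1 ∈ S ∧ q.2 ∈ S) : rowVal r q ∈ S := by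
  rcases r with _ | t
  · exact h.1
  · exact S.sub_mem h.2 (S.smul_mem t h.1)

theorem rowVal_inj {r s : Option (ZMod p)} (h : r ≠ s) {q q' : V × V}
    (hr : rowVal r q = rowVal r q') (hs : rowVal s q = rowVal s q') : q = q' := by
  have := mem_of_rowVal_mem (S := ⊥) (q := q - q') h
    (by rw [map_sub, hr, sub_self]; exact zero_mem _)
    (by rw [map_sub, hs, sub_self]; exact zero_mem _)
  exact sub_eq_zero.1 (Prod.ext (by simpa using this.1) (by simpa using this.2))

theorem exists_rowVal {r s : Option (ZMod p)} (h : r ≠ s) (v w : V) :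
    ∃ q : V × V, rowVal r q = v ∧ rowVal s q = w := by
  rcases r with _ | r <;> rcases s with _ | s
  · exact (h rfl).elim
  · exact ⟨(v, w + s • v), by simp⟩
  · exact ⟨(w, v + r • w), by simp⟩
  · have hne : s - r ≠ 0 := sub_ne_zero.2 fun e => h (by rw [e])
    refine ⟨((s - r)⁻¹ • (v - w), v + r • (s - r)⁻¹ • (v - w)), by simp, ?_⟩
    have : (s - r) • (s - r)⁻¹ • (v - w) = v - w := by
      rw [smul_smul, mul_inv_cancel₀ hne, one_smul]
    rw [rowVal_some, add_sub_assoc, ← sub_smul, ← neg_sub s r, neg_smul, this]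
    abel

/-- The Pasch property of ordinary lines in coordinates. -/
theorem exists_rowVal_eq {r₀ r₁ r₂ r₃ r₄ : Option (ZMod p)} {q₁ q₂ q₃ q₄ : V × V}
    (h₁₂ : r₁ ≠ r₂) (h₃₄ : r₃ ≠ r₄) (h₀ : rowVal r₀ q₁ = rowVal r₀ q₂)
    (h₁ : rowVal r₁ q₁ = rowVal r₁ q₃) (h₂ : rowVal r₂ q₂ = rowVal r₂ q₃)
    (h₃ : rowVal r₃ q₁ = rowVal r₃ q₄) (h₄ : rowVal r₄ q₂ = rowVal r₄ q₄) :
    ∃ r : Option (ZMod p), rowVal r q₃ = rowVal r q₄ := by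
  -- Agreement on row `r₀` is one linear relation between the coordinates of `q₁ - q₂`, so both are
  -- multiples of a single vector `w`. This passes on to `q₁ - q₃`, `q₁ - q₄` and `q₃ - q₄`.
  obtain ⟨w, hw⟩ : ∃ w : V, (q₁ - q₂).1 ∈ Submodule.span (ZMod p) {w} ∧
      (q₁ - q₂).2 ∈ Submodule.span (ZMod p) {w} := by
    have h := sub_eq_zero.2 h₀
    rw [← map_sub] at h
    rcases r₀ with _ | t
    · rw [rowVal_none] at h
      exact ⟨(q₁ - q₂).2, h ▸ zero_mem _, Submodule.mem_span_singleton_self _⟩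
    · rw [rowVal_some, sub_eq_zero] at h
      exact ⟨(q₁ - q₂).1, Submodule.mem_span_singleton_self _,
        h ▸ Submodule.smul_mem _ t (Submodule.mem_span_singleton_self _)⟩
  set S := Submodule.span (ZMod p) {w}
  have aux : ∀ {r s : Option (ZMod p)} {q : V × V}, r ≠ s → rowVal r q₁ = rowVal r q →
      rowVal s q₂ = rowVal s q → (q₁ - q).1 ∈ S ∧ (q₁ - q).2 ∈ S := by
    intro r s q hrs hr hs
    refine mem_of_rowVal_mem hrs ?_ ?_
    · rw [map_sub, hr, sub_self]
      exact zero_mem _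
    · rw [map_sub, ← hs, ← map_sub]
      exact rowVal_mem s hw
  obtain ⟨a1, a2⟩ := aux h₁₂ h₁ h₂
  obtain ⟨b1, b2⟩ := aux h₃₄ h₃ h₄
  have c1 : (q₃ - q₄).1 ∈ S := by simpa using S.sub_mem b1 a1
  have c2 : (q₃ - q₄).2 ∈ S := by simpa using S.sub_mem b2 a2
  obtain ⟨x, hx⟩ := Submodule.mem_span_singleton.1 c1
  obtain ⟨y, hy⟩ := Submodule.mem_span_singleton.1 c2
  -- Here `q₃ - q₄ = (x • w, y • w)`, which vanishes on row `∞` if `x = 0`, and on row `y / x`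
  -- otherwise.
  by_cases hx0 : x = 0
  · refine ⟨none, sub_eq_zero.1 ?_⟩
    rw [← map_sub, rowVal_none, ← hx, hx0, zero_smul]
  · refine ⟨some (y / x), sub_eq_zero.1 ?_⟩
    rw [← map_sub, rowVal_some, ← hx, ← hy, smul_smul, div_mul_cancel₀ _ hx0, sub_self]

theorem rectInc_unique {x y : RectPoint p V} (hxy : x ≠ y) {l l' : RectLine p V}
    (hx : rectInc x l) (hy : rectInc y l) (hx' : rectInc x l') (hy' : rectInc y l') : l = l' := by
  rcases x with _ | ⟨r, v⟩ <;> rcases y with _ | ⟨s, w⟩ <;> rcases l with m | q <;>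
    rcases l' with m' | q' <;> simp only [rectInc_none_inl, rectInc_none_inr, rectInc_some_inl,
      rectInc_some_inr] at hx hy hx' hy'
  case some.some.inr.inr =>
    exact congrArg Sum.inr (rowVal_inj (fun e => hxy (by rw [hx, hy, e])) (hx.symm.trans hx')
      (hy.symm.trans hy'))
  all_goals grind

omit [Fact p.Prime] in
theorem rect_special_inter (r : Option (ZMod p)) {l : RectLine p V} (hl : l ≠ .inl r) :
    ∃! x : RectPoint p V, rectInc x (.inl r) ∧ rectInc x l := by
  rcases l with s | q
  · refine ⟨none, by simp, ?_⟩
    rintro (_ | ⟨t, v⟩) ⟨h1, h2⟩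
    · rfl
    · rw [rectInc_some_inl] at h1 h2
      exact (hl (by rw [← h1, ← h2])).elim
  · refine ⟨some (r, rowVal r q), by simp, ?_⟩
    rintro (_ | ⟨t, v⟩) ⟨h1, h2⟩
    · exact h2.elim
    · rw [rectInc_some_inl] at h1
      rw [rectInc_some_inr] at h2
      subst h1 h2
      rfl

variable (p V) in
theorem rect_isProjectiveRectangle [Nontrivial V] :
    IsProjectiveRectangle (rectInc (p := p) (V := V)) none where
  existsUnique_line x y hxy := by
    refine existsUnique_of_exists_of_unique ?_
      fun l l' h h' => rectInc_unique hxy h.1 h.2 h'.1 h'.2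
    rcases x with _ | ⟨r, v⟩ <;> rcases y with _ | ⟨s, w⟩
    · exact (hxy rfl).elim
    · exact ⟨.inl s, by simp⟩
    · exact ⟨.inl r, by simp⟩
    · by_cases hrs : r = s
      · exact ⟨.inl r, by simp [hrs]⟩
      · obtain ⟨q, h1, h2⟩ := exists_rowVal hrs v w
        exact ⟨.inr q, by simp [h1, h2]⟩
  exists_four := by
    obtain ⟨v, hv⟩ := exists_ne (0 : V)
    refine ⟨![some (none, 0), some (none, v), some (some 0, 0), some (some 0, v)], ?_, ?_⟩
    · intro i j
      fin_cases i <;> fin_cases j <;> simp [hv, hv.symm]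
    · rintro i j k hij hik hjk ⟨l | q, h1, h2, h3⟩
      · fin_cases i <;> fin_cases j <;> fin_cases k <;> simp at hij hik hjk h1 h2 h3 <;>
          grind
      · fin_cases i <;> fin_cases j <;> fin_cases k <;> simp at hij hik hjk h1 h2 h3 <;>
          apply hv <;> grind
  three_points l := by
    obtain ⟨v, hv⟩ := exists_ne (0 : V)
    rcases l with r | q
    · exact ⟨none, some (r, 0), some (r, v), by simp [hv.symm]⟩
    · exact ⟨some (none, rowVal none q), some (some 0, rowVal (some 0) q),
        some (some 1, rowVal (some 1) q), by simp, by simp, by simp, rfl, rfl, rfl⟩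
  special_inter s l hs hl := by
    rcases s with r | q
    · exact rect_special_inter r hl
    · exact hs.elim
  pasch := by
    intro l₁ l₂ hl₁ hl₂ _ hx l₃ l₄ h₃₄ y₁ y₂ y₃ y₄ hy h₁₁ h₁₃ h₂₂ h₂₃ h₃₁ h₃₄' h₄₂ h₄₄
    rcases l₁ with r | q₁
    · exact (hl₁ trivial).elim
    rcases l₂ with r | q₂
    · exact (hl₂ trivial).elim
    rcases l₃ with r | q₃
    · exact rect_special_inter r h₃₄.symm
    rcases l₄ with r | q₄
    · simpa only [and_comm] using rect_special_inter r h₃₄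
    refine existsUnique_of_exists_of_unique ?_ fun x y h h' => ?_
    · obtain ⟨_ | ⟨r₀, v₀⟩, hx₁, hx₂⟩ := hx
      · exact hx₁.elim
      rcases y₁ with _ | ⟨r₁, v₁⟩
      · exact h₁₁.elim
      rcases y₂ with _ | ⟨r₂, v₂⟩
      · exact h₂₂.elim
      rcases y₃ with _ | ⟨r₃, v₃⟩
      · exact h₃₁.elim
      rcases y₄ with _ | ⟨r₄, v₄⟩
      · exact h₄₂.elim
      rw [rectInc_some_inr] at *
      -- Both `y₁` and `y₂` lie on `l₃`, which has only one point in each row.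
      have h₁₂ : r₁ ≠ r₂ := by
        rintro rfl
        simp [h₁₃, h₂₃] at hy
      have h₃₄ : r₃ ≠ r₄ := by
        rintro rfl
        simp [h₃₄', h₄₄] at hy
      obtain ⟨r, hr⟩ := exists_rowVal_eq h₁₂ h₃₄ (hx₁.symm.trans hx₂) (h₁₁.symm.trans h₁₃)
        (h₂₂.symm.trans h₂₃) (h₃₁.symm.trans h₃₄') (h₄₂.symm.trans h₄₄)
      exact ⟨some (r, rowVal r q₃), rfl, hr⟩
    · by_contra hne
      exact h₃₄ (rectInc_unique hne h.1 h'.1 h.2 h'.2)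

theorem rectLine_ext [Nontrivial V] {l l' : RectLine p V} (h : ∀ x, rectInc x l ↔ rectInc x l') :
    l = l' := by
  obtain ⟨x, y, -, hxy, -, -, hx, hy, -⟩ := (rect_isProjectiveRectangle p V).three_points l
  exact rectInc_unique hxy hx hy ((h x).1 hx) ((h y).1 hy)

/-- The special lines of the coordinate model. -/
def rectSpecialEquiv (p : ℕ) (V : Type u) [AddCommGroup V] [Module (ZMod p) V] :
    {l : RectLine p V // rectInc none l} ≃ Option (ZMod p) where
  toFun l := match l with
    | ⟨.inl r, _⟩ => r
  invFun r := ⟨.inl r, trivial⟩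
  left_inv := by rintro ⟨r | q, h⟩ <;> trivial
  right_inv r := rfl

/-- The points of a special line of the coordinate model. -/
def rectRowEquiv (V : Type u) [AddCommGroup V] [Module (ZMod p) V] (r : Option (ZMod p)) :
    {x : RectPoint p V // rectInc x (.inl r)} ≃ Option V where
  toFun x := x.1.map Prod.snd
  invFun v := ⟨v.map (Prod.mk r), by cases v <;> simp⟩
  left_inv := by
    rintro ⟨_ | ⟨s, v⟩, h⟩
    · rfl
    · rw [rectInc_some_inl] at h
      subst h
      rfl
  right_inv := by rintro (_ | v) <;> rfl

end CoordinateRectangle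

/-! ### Transport along isomorphisms of incidence structures. -/

section Transport

variable {P : Type*} {L : Type*} {P' : Type*} {L' : Type*} {I : P → L → Prop} {I' : P' → L' → Prop}

theorem IsProjectiveRectangle.congr {D : P} (h : IsProjectiveRectangle I D) (e : P ≃ P')
    (f : L ≃ L') (hef : ∀ x l, I' (e x) (f l) ↔ I x l) : IsProjectiveRectangle I' (e D) where
  existsUnique_line := by
    intro x y hxy
    obtain ⟨x, rfl⟩ := e.surjective x
    obtain ⟨y, rfl⟩ := e.surjective y
    refine (f.existsUnique_congr fun l => by rw [hef, hef]).1 ?_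
    exact h.existsUnique_line x y (fun h => hxy (by rw [h]))
  exists_four := by
    obtain ⟨q, hq, hq'⟩ := h.exists_four
    refine ⟨e ∘ q, e.injective.comp hq, fun i j k h1 h2 h3 ⟨l, hl⟩ => hq' i j k h1 h2 h3 ?_⟩
    obtain ⟨l, rfl⟩ := f.surjective l
    exact ⟨l, by simpa [hef] using hl⟩
  three_points := by
    intro l
    obtain ⟨l, rfl⟩ := f.surjective l
    obtain ⟨x, y, z, hx⟩ := h.three_points l
    exact ⟨e x, e y, e z, by simpa [hef] using hx⟩
  special_inter := by
    intro s l
    obtain ⟨s, rfl⟩ := f.surjective s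
    obtain ⟨l, rfl⟩ := f.surjective l
    intro hs hl
    refine (e.existsUnique_congr fun x => by rw [hef, hef]).1 ?_
    exact h.special_inter s l ((hef _ _).1 hs) (fun h => hl (by rw [h]))
  pasch := by
    intro l₁ l₂ hl₁ hl₂ h₁₂ hx l₃ l₄ h₃₄ y₁ y₂ y₃ y₄ hy h1 h2 h3 h4 h5 h6 h7 h8
    obtain ⟨l₁, rfl⟩ := f.surjective l₁
    obtain ⟨l₂, rfl⟩ := f.surjective l₂
    obtain ⟨l₃, rfl⟩ := f.surjective l₃
    obtain ⟨l₄, rfl⟩ := f.surjective l₄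
    obtain ⟨y₁, rfl⟩ := e.surjective y₁
    obtain ⟨y₂, rfl⟩ := e.surjective y₂
    obtain ⟨y₃, rfl⟩ := e.surjective y₃
    obtain ⟨y₄, rfl⟩ := e.surjective y₄
    obtain ⟨x, hx⟩ := hx
    obtain ⟨x, rfl⟩ := e.surjective x
    simp only [hef] at hl₁ hl₂ hx h1 h2 h3 h4 h5 h6 h7 h8
    refine (e.existsUnique_congr fun x => by rw [hef, hef]).1 ?_
    exact h.pasch l₁ l₂ hl₁ hl₂ (fun h => h₁₂ (by rw [h])) ⟨x, hx⟩
      l₃ l₄ (fun h => h₃₄ (by rw [h])) y₁ y₂ y₃ y₄ (.of_map e hy) h1 h2 h3 h4 h5 h6 h7 h8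

theorem hasOrder_of_equiv {D : P} {A B : Type w} (eA : {l // I D l} ≃ Option A) {l : L} (hl : I D l)
    (eB : {x // I x l} ≃ Option B) : HasOrder I D (Cardinal.mk A) (Cardinal.mk B) := by
  refine ⟨?_, l, hl, ?_⟩ <;> rw [← Cardinal.mk_option, Cardinal.lift_mk_eq']
  exacts [⟨eA⟩, ⟨eB⟩]

end Transport

/-! ### Rectangles realized in a matroid, and closure of their ordinary lines under conjugation. -/

section Realization

variable {p : ℕ} {V : Type u} [AddCommGroup V] [Module (ZMod p) V] {α : Type v} {M : Matroid α}

/-- A realization of the coordinate rectangle by points of a matroid, with respect to collinear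
triples. -/
structure RectRealization (M : Matroid α) (D : MPoint M) (X : Option (ZMod p) → V → MPoint M) :
    Prop where
  row_coll : ∀ r v w, Coll M D (X r v) (X r w)
  row_inj : ∀ r, Function.Injective (X r)
  not_coll : ∀ {r s}, r ≠ s → ∀ v w, ¬ Coll M D (X r v) (X s w)
  line_coll : ∀ r s t q, Coll M (X r (rowVal r q)) (X s (rowVal s q)) (X t (rowVal t q))

/-- The point of `M` that represents a point of the coordinate rectangle. -/
def rectMap (D : MPoint M) (X : Option (ZMod p) → V → MPoint M) : RectPoint p V → MPoint M
  | none => D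
  | some (r, v) => X r v

namespace RectRealization

variable {D : MPoint M} {X : Option (ZMod p) → V → MPoint M}

theorem ne_D [Fact p.Prime] (R : RectRealization M D X) (r : Option (ZMod p)) (v : V) :
    X r v ≠ D := by
  obtain ⟨s, hs⟩ := exists_ne r
  exact (ne_of_not_coll (R.not_coll hs.symm v 0)).1.symm

theorem ne (R : RectRealization M D X) {r s : Option (ZMod p)} (h : r ≠ s) (v w : V) :
    X r v ≠ X s w :=
  (ne_of_not_coll (R.not_coll h v w)).2.2

theorem rectMap_injective [Fact p.Prime] (R : RectRealization M D X) :
    Function.Injective (rectMap D X) := by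
  rintro (_ | ⟨r, v⟩) (_ | ⟨s, w⟩) h
  · rfl
  · exact (R.ne_D s w h.symm).elim
  · exact (R.ne_D r v h).elim
  · rcases eq_or_ne r s with rfl | hrs
    · rw [R.row_inj r h]
    · exact (R.ne hrs v w h).elim

/-- A point off an ordinary line is not collinear with two points of the line. -/
theorem not_coll_line (R : RectRealization M D X) {r s t : Option (ZMod p)} (h : r ≠ s)
    {q : V × V} {w : V} (hw : w ≠ rowVal t q) :
    ¬ Coll M (X r (rowVal r q)) (X s (rowVal s q)) (X t w) := by
  intro hc
  -- Otherwise the ordinary line contains two points of row `t`, hence also `D`.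
  have hne : X t w ≠ X t (rowVal t q) := fun e => hw (R.row_inj t e)
  refine R.not_coll h (rowVal r q) (rowVal s q) (Coll.rotate (coll_of_coll hne ?_ ?_ ?_)).rotate
  · exact coll_of_coll (R.ne h _ _) hc (R.line_coll r s t q) (coll_self_outer _ _)
  · exact coll_of_coll (R.ne h _ _) hc (R.line_coll r s t q) (coll_self_right _ _)
  · exact (R.row_coll t w _).rotate

/-- Three points of an ordinary line have their harmonic conjugate on the line. -/
theorem exists_config [Fact p.Prime] [Nontrivial V] (R : RectRealization M D X)
    {r₁ r₂ r₃ : Option (ZMod p)} (h₁₂ : r₁ ≠ r₂) (h₁₃ : r₁ ≠ r₃) (h₂₃ : r₂ ≠ r₃) (q : V × V) :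
    ∃ a₁ a₂ a₃ a₄ r, HarmonicConfig M (X r₁ (rowVal r₁ q)) (X r₂ (rowVal r₂ q))
      (X r₃ (rowVal r₃ q)) a₁ a₂ a₃ a₄ ∧ Coll M a₁ a₃ (X r (rowVal r q)) := by
  -- Take `D` as the vertex `a₂` and any other point of row `r₁` as `a₁`. Then `m₁` joins `a₁` to
  -- `f` and gives `a₄` on row `r₂`, `m₂` joins `d` to `a₄` and gives `a₃` on row `r₃`, and `m₃` is
  -- the diagonal `a₁a₃`.
  obtain ⟨w, hw⟩ := exists_ne (rowVal r₁ q)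
  obtain ⟨m₁, h11, h13⟩ := exists_rowVal h₁₃ w (rowVal r₃ q)
  obtain ⟨m₂, h21, h22⟩ := exists_rowVal h₁₂ (rowVal r₁ q) (rowVal r₂ m₁)
  obtain ⟨m₃, h31, h33⟩ := exists_rowVal h₁₃ (rowVal r₁ m₁) (rowVal r₃ m₂)
  -- The lines `m₁` and `m₂` meet in `a₄`, and both `q` and `m₃` cross them, so `q` and `m₃` meet by
  -- the Pasch property.
  obtain ⟨r, hr⟩ := exists_rowVal_eq h₁₃.symm h₁₃ h22.symm h13 h21 h31.symm h33.symm
  have n11 : rowVal r₁ m₁ ≠ rowVal r₁ q := by rwa [h11]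
  have n12 : rowVal r₂ m₁ ≠ rowVal r₂ q := fun e => n11 (by rw [rowVal_inj h₂₃ e h13])
  have n23 : rowVal r₃ m₂ ≠ rowVal r₃ q := fun e => n12 (by rw [← h22, rowVal_inj h₁₃ h21 e])
  refine ⟨X r₁ (rowVal r₁ m₁), D, X r₃ (rowVal r₃ m₂), X r₂ (rowVal r₂ m₁), r,
    ⟨⟨R.ne h₁₂ _ _, R.ne h₁₃ _ _, R.ne h₂₃ _ _⟩, R.line_coll _ _ _ q,
      ⟨R.not_coll_line h₁₃ n11, ?_, R.not_coll_line h₁₃ n23, R.not_coll_line h₁₃ n12⟩,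
      ⟨?_, ?_, ?_, R.not_coll h₂₃.symm _ _⟩, ?_, ?_, ?_, ?_, ?_⟩, ?_⟩
  · exact fun hc => R.not_coll h₁₃ _ _ (Coll.rotate hc).rotate
  · exact fun hc => R.not_coll h₁₃ _ _ (Coll.swap_left hc)
  · exact fun hc => R.not_coll h₁₂ _ _ (Coll.swap_left hc)
  · exact fun hc => R.not_coll_line h₁₂ (fun e => n23 (e.trans h13)) (Coll.swap_right hc)
  · exact (R.row_coll r₁ _ _).rotate
  · rw [← h21, ← h22]
    exact R.line_coll _ _ _ m₂
  · exact (R.row_coll r₂ _ _).rotate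
  · rw [← h13]
    exact R.line_coll _ _ _ m₁
  · exact (R.row_coll r₃ _ _).rotate
  · rw [hr, ← h31, ← h33]
    exact R.line_coll _ _ _ m₃

/-- The conjugate is independent of the configuration, so it may be computed from the one inside the
rectangle. -/
theorem harmonicStep_line_subset [Fact p.Prime] [Nontrivial V] (R : RectRealization M D X)
    (q : V × V) : harmonicStep M (Set.range fun r => X r (rowVal r q)) ⊆
      Set.range fun r => X r (rowVal r q) := by
  rintro x (hx | ⟨_, ⟨r₁, rfl⟩, _, ⟨r₂, rfl⟩, _, ⟨r₃, rfl⟩, hx⟩)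
  · exact hx
  · obtain ⟨a₁, a₂, a₃, a₄, hc⟩ := hx.1
    obtain ⟨n1, n2, n3⟩ := hc.base_ne
    obtain ⟨a₁, a₂, a₃, a₄, r, hc, hr⟩ := R.exists_config (r₁ := r₁) (r₂ := r₂) (r₃ := r₃)
      (fun e => n1 (by rw [e])) (fun e => n2 (by rw [e])) (fun e => n3 (by rw [e])) q
    exact ⟨r, hc.eq_of_coll hr (R.line_coll _ _ _ q) (hx.coll hc).1 (hx.coll hc).2⟩

end RectRealization

theorem subset_harmonicStep (S : Set (MPoint M)) : S ⊆ harmonicStep M S := Set.subset_union_left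

theorem harmonicStep_mono : Monotone (harmonicStep M) := by
  rintro S T h x (hx | ⟨a, ha, b, hb, c, hc, hx⟩)
  · exact .inl (h hx)
  · exact .inr ⟨a, h ha, b, h hb, c, h hc, hx⟩

theorem harmonicClosure_subset {S T : Set (MPoint M)} (h : S ⊆ T) (hT : harmonicStep M T ⊆ T) :
    harmonicClosure M S ⊆ T := by
  refine Set.iUnion_subset fun n => ?_
  induction n with
  | zero => exact h
  | succ n ih =>
    rw [Function.iterate_succ_apply']
    exact (harmonicStep_mono ih).trans hT

theorem subset_harmonicClosure (S : Set (MPoint M)) : S ⊆ harmonicClosure M S :=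
  Set.subset_iUnion_of_subset 0 subset_rfl

theorem Hc.mem_harmonicClosure {S : Set (MPoint M)} {a b c x : MPoint M} (h : Hc M a c b x)
    (ha : a ∈ harmonicClosure M S) (hb : b ∈ harmonicClosure M S)
    (hc : c ∈ harmonicClosure M S) : x ∈ harmonicClosure M S := by
  have mono : Monotone fun n => (harmonicStep M)^[n] S := monotone_nat_of_le_succ fun n => by
    rw [Function.iterate_succ_apply']
    exact subset_harmonicStep _
  obtain ⟨i, hi⟩ := Set.mem_iUnion.1 ha
  obtain ⟨j, hj⟩ := Set.mem_iUnion.1 hb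
  obtain ⟨k, hk⟩ := Set.mem_iUnion.1 hc
  refine Set.mem_iUnion.2 ⟨max i (max j k) + 1, ?_⟩
  rw [Function.iterate_succ_apply']
  exact .inr ⟨a, mono (by simp) hi, b, mono (by simp) hj, c, mono (by simp) hk, h⟩

end Realization

/-! ### The iterated rows realize the coordinate rectangle. -/

section Rows

variable {p : ℕ} {V : Type u} [AddCommGroup V] [Module (ZMod p) V] {α : Type v} {M : Matroid α}
  {D : MPoint M} {a : V → MPoint M} {x : ℕ → V → MPoint M}

theorem LpFrame.ne_a (F : ∀ t, LpFrame M D a (x t) (x (t + 1))) (g : V) (t : ℕ) (h : V) :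
    a g ≠ x t h := (ne_of_not_coll ((F t).ab g h)).2.2

/-- Along a line of slope `g`, passing to the next row subtracts `g` from the index. -/
theorem LpFrame.coll_add (F : ∀ t, LpFrame M D a (x t) (x (t + 1))) (g : V) (s n : ℕ) (h : V) :
    Coll M (a g) (x s h) (x (s + n) (h - n • g)) := by
  induction n with
  | zero => simpa using coll_self_right _ _
  | succ n ih =>
    have h1 := (F (s + n)).abc g (h - (n + 1) • g)
    rw [show g + (h - (n + 1) • g) = h - n • g by rw [succ_nsmul]; abel] at h1
    exact Coll.trans (ne_a F _ _ _) ih.swap_right h1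

theorem LpFrame.coll_zero (F : ∀ t, LpFrame M D a (x t) (x (t + 1))) (q : V × V) (t : ZMod p)
    [NeZero p] : Coll M (a q.1) (x 0 q.2) (x t.val (rowVal (some t) q)) := by
  have := coll_add F q.1 0 t.val q.2
  rwa [zero_add, ← Nat.cast_smul_eq_nsmul (ZMod p), ZMod.natCast_zmod_val] at this

theorem LpFrame.not_coll_rows [Fact p.Prime] [Nontrivial V]
    (F : ∀ t, LpFrame M D a (x t) (x (t + 1))) {s n : ℕ} (hn : 0 < n) (hnp : n < p) (h k : V) :
    ¬ Coll M D (x s h) (x (s + n) k) := by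
  intro hc
  have hD : ∀ t h, D ≠ x t h := fun t h => (ne_of_not_coll ((F t).ab 0 h)).2.1
  -- If both rows lay on one line through `D`, the line through `a g` and `x s h` would meet it only
  -- once, whatever `g` is. Comparing two values of `g` then gives `n • v = 0` with `v ≠ 0` and `0 <
  -- n < p`.
  have key : ∀ g, x s h = x (s + n) (h - n • g) := by
    intro g
    by_contra hne
    have h1 : Coll M D (x s h) (x (s + n) (h - n • g)) :=
      coll_of_coll (hD (s + n) k) (coll_self_outer _ _) hc.swap_right ((F _).bb _ _)
    refine (F s).ab g h ?_
    exact coll_of_coll hne h1.rotate (coll_add F g s n h).rotate (coll_self_outer _ _)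
  obtain ⟨v, hv⟩ := exists_ne (0 : V)
  have h0 := (F (s + n)).b_inj ((key 0).symm.trans (key v))
  rw [← Nat.cast_smul_eq_nsmul (ZMod p), ← Nat.cast_smul_eq_nsmul (ZMod p), smul_zero, sub_zero,
    eq_comm, sub_eq_self, smul_eq_zero, ZMod.natCast_eq_zero_iff] at h0
  exact h0.elim (fun hd => Nat.not_dvd_of_pos_of_lt hn hnp hd) hv

/-- The rows as a realization of the coordinate rectangle. -/
theorem LpFrame.realization [Fact p.Prime] [Nontrivial V]
    (F : ∀ t, LpFrame M D a (x t) (x (t + 1))) :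
    RectRealization M D (fun (r : Option (ZMod p)) => r.elim a fun t => x t.val) where
  row_coll := by
    rintro (_ | t) v w
    · exact (F 0).aa v w
    · exact (F t.val).bb v w
  row_inj := by
    rintro (_ | t)
    · exact (F 0).a_inj
    · exact (F t.val).b_inj
  not_coll := by
    have aux : ∀ (s t : ZMod p), s.val < t.val → ∀ v w, ¬ Coll M D (x s.val v) (x t.val w) := by
      intro s t hst v w
      obtain ⟨n, hn⟩ := Nat.exists_eq_add_of_lt hst
      have := t.val_lt
      have h2 := not_coll_rows F (p := p) (s := s.val) (n := n + 1) (by omega) (by omega) v w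
      rwa [hn]
    rintro (_ | s) (_ | t) hst v w
    · exact (hst rfl).elim
    · exact (F _).ab v w
    · exact fun hc => (F _).ab w v hc.swap_right
    · have hne : s.val ≠ t.val := fun e => hst (by rw [ZMod.val_injective p e])
      rcases lt_or_gt_of_ne hne with h | h
      · exact aux s t h v w
      · exact fun hc => aux t s h w v hc.swap_right
  line_coll := by
    intro r s t q
    have aux : ∀ r : Option (ZMod p), Coll M (a q.1) (x 0 q.2)
        (r.elim a (fun t => x t.val) (rowVal r q)) := by
      rintro (_ | t)
      · exact coll_self_outer _ _
      · exact coll_zero F q t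
    exact coll_of_coll (ne_a F _ _ _) (aux r) (aux s) (aux t)

end Rows

/-! ### Identification of the system with the coordinate rectangle. -/

section RectangleOfRows

variable {p : ℕ} {V : Type u} [AddCommGroup V] [Module (ZMod p) V] {α : Type v} {M : Matroid α}

theorem RectRealization.range_line (D : MPoint M) (X : Option (ZMod p) → V → MPoint M)
    (q : V × V) : (Set.range fun r => X r (rowVal r q)) =
      rectMap D X '' {y | rectInc y (.inr q)} := by
  ext y
  constructor
  · rintro ⟨r, rfl⟩
    exact ⟨some (r, rowVal r q), rfl, rfl⟩
  · rintro ⟨_ | ⟨r, v⟩, h, rfl⟩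
    · exact h.elim
    · exact ⟨r, by rw [(h : v = rowVal r q)]; rfl⟩

theorem RectRealization.image_row (D : MPoint M) (X : Option (ZMod p) → V → MPoint M)
    (r : Option (ZMod p)) : rectMap D X '' {y | rectInc y (.inl r)} =
      insert D (Set.range (X r)) := by
  ext y
  constructor
  · rintro ⟨_ | ⟨s, v⟩, h, rfl⟩
    · exact .inl rfl
    · exact .inr ⟨v, by rw [← (h : s = r)]; rfl⟩
  · rintro (rfl | ⟨v, rfl⟩)
    · exact ⟨none, trivial, rfl⟩
    · exact ⟨some (r, v), rfl, rfl⟩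

variable {φ : LPoint V → MPoint M} {x : ℕ → V → MPoint M}

/-- The points of all rows, indexed as in the coordinate rectangle. -/
def rowPoints (p : ℕ) (φ : LPoint V → MPoint M) (x : ℕ → V → MPoint M) :
    Option (ZMod p) → V → MPoint M :=
  fun r => r.elim (fun g => φ (.a g)) fun t => x t.val

variable [Nontrivial V] (hM : IsHarmonic M) (hx₀ : x 0 = fun h => φ (.b h))
  (hx₁ : x 1 = fun h => φ (.c h))
  (F : ∀ t, LpFrame M (φ .D) (fun g => φ (.a g)) (x t) (x (t + 1)))

include hM hx₀ hx₁ F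

/-- Uniqueness of conjugates makes the inductive relation single-valued. -/
theorem isRowPoint_iff (t : ℕ) (h : V) (y : MPoint M) : IsRowPoint φ t h y ↔ y = x t h := by
  have hH : ∀ t h, Hc M (φ (.a 0)) (x (t + 1) h) (x t h) (x (t + 2) h) := fun t h => by
    simpa using (F t).hc hM (F (t + 1)) 0 h
  constructor
  · intro hy
    induction hy with
    | zero h => rw [hx₀]
    | one h => rw [hx₁]
    | step _ _ hc ih₁ ih₂ =>
      subst ih₁ ih₂
      exact hc.unique (hH _ _)
  · rintro rfl
    suffices IsRowPoint φ t h (x t h) ∧ IsRowPoint φ (t + 1) h (x (t + 1) h) from this.1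
    induction t with
    | zero =>
      rw [zero_add, hx₀, hx₁]
      exact ⟨.zero h, .one h⟩
    | succ t ih => exact ⟨ih.2, .step ih.1 ih.2 (hH t h)⟩

theorem row_eq_insert_range (t : ℕ) : row φ t = insert (φ .D) (Set.range (x t)) := by
  unfold row
  congr 1
  ext y
  simp only [isRowPoint_iff hM hx₀ hx₁ F, Set.mem_ofPred_eq, Set.mem_range, eq_comm]

/-- The right side is closed under conjugation, which bounds the closure. Conversely, conjugating
with respect to `a_g` and the latest point reaches row after row. -/
theorem ordLine_eq_range [Fact p.Prime] (g h : V) : ordLine φ g h =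
    Set.range fun r : Option (ZMod p) => rowPoints p φ x r (rowVal r (g, g + h)) := by
  have R : RectRealization M (φ .D) (rowPoints p φ x) := LpFrame.realization F
  apply subset_antisymm
  · refine harmonicClosure_subset ?_ (R.harmonicStep_line_subset _)
    rintro y (rfl | rfl | rfl)
    · exact ⟨none, rfl⟩
    · exact ⟨some 0, by simp [rowPoints, hx₀]⟩
    · have := Fact.mk (Fact.out : p.Prime).one_lt
      exact ⟨some 1, by simp [rowPoints, hx₁, ZMod.val_one]⟩
  · have ha : φ (.a g) ∈ ordLine φ g h := subset_harmonicClosure _ (by simp)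
    have key : ∀ n : ℕ, x n (g + h - n • g) ∈ ordLine φ g h ∧
        x (n + 1) (g + h - (n + 1) • g) ∈ ordLine φ g h := by
      intro n
      induction n with
      | zero =>
        rw [hx₀, zero_add, hx₁]
        exact ⟨subset_harmonicClosure _ (by simp), subset_harmonicClosure _ (by simp)⟩
      | succ n ih =>
        refine ⟨ih.2, ?_⟩
        have hH := (F n).hc hM (F (n + 1)) g (g + h - (n + 1) • g)
        rw [show g + (g + h - (n + 1) • g) = g + h - n • g by rw [succ_nsmul]; abel,
          sub_sub, ← succ_nsmul] at hH
        exact hH.mem_harmonicClosure ha ih.1 ih.2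
    rintro _ ⟨_ | t, rfl⟩
    · exact ha
    · have := (key t.val).1
      rwa [← Nat.cast_smul_eq_nsmul (ZMod p), ZMod.natCast_zmod_val] at this

theorem image_rectInc_mem_prLines [Fact p.Prime] (l : RectLine p V) :
    rectMap (φ .D) (rowPoints p φ x) '' {y | rectInc y l} ∈ prLines p φ := by
  rcases l with (_ | t) | ⟨g, k⟩
  · rw [RectRealization.image_row]
    exact .inl (.inl rfl)
  · rw [RectRealization.image_row]
    exact .inl (.inr ⟨t.val, t.val_lt, (row_eq_insert_range hM hx₀ hx₁ F t.val).symm⟩)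
  · refine .inr ⟨g, k - g, ?_⟩
    rw [ordLine_eq_range (p := p) hM hx₀ hx₁ F, RectRealization.range_line (φ .D),
      add_sub_cancel]

theorem exists_image_rectInc_eq [Fact p.Prime] {l : Set (MPoint M)} (hl : l ∈ prLines p φ) :
    ∃ m : RectLine p V, rectMap (φ .D) (rowPoints p φ x) '' {y | rectInc y m} = l := by
  rcases hl with (rfl | ⟨t, ht, rfl⟩) | ⟨g, h, rfl⟩
  · exact ⟨.inl none, RectRealization.image_row _ _ _⟩
  · refine ⟨.inl (some (t : ZMod p)), ?_⟩
    rw [RectRealization.image_row, row_eq_insert_range hM hx₀ hx₁ F]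
    simp [rowPoints, ZMod.val_cast_of_lt ht]
  · refine ⟨.inr (g, g + h), ?_⟩
    rw [ordLine_eq_range (p := p) hM hx₀ hx₁ F, RectRealization.range_line (φ .D)]

theorem range_rectMap_eq_prPoints [Fact p.Prime] :
    Set.range (rectMap (φ .D) (rowPoints p φ x)) = prPoints φ := by
  apply subset_antisymm
  · rintro _ ⟨_ | ⟨r, v⟩, rfl⟩
    · exact .inl rfl
    -- Any ordinary line through the point will do; the one with value `0` on another row `s` is
    -- taken.
    · obtain ⟨s, hs⟩ := exists_ne r
      obtain ⟨⟨g, k⟩, hq, -⟩ := exists_rowVal hs.symm v 0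
      refine .inr (Set.mem_iUnion₂.2 ⟨g, k - g, ?_⟩)
      rw [ordLine_eq_range (p := p) hM hx₀ hx₁ F, add_sub_cancel]
      exact ⟨r, by subst hq; rfl⟩
  · rintro _ (rfl | hy)
    · exact ⟨none, rfl⟩
    · obtain ⟨g, h, hy⟩ := Set.mem_iUnion₂.1 hy
      rw [ordLine_eq_range (p := p) hM hx₀ hx₁ F, RectRealization.range_line (φ .D)] at hy
      exact Set.image_subset_range _ _ hy

theorem range_rectMap_eq_rows [Fact p.Prime] :
    Set.range (rectMap (φ .D) (rowPoints p φ x)) = rowInfty φ ∪ ⋃ t : Fin p, row φ t := by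
  apply subset_antisymm
  · rintro _ ⟨_ | ⟨_ | t, v⟩, rfl⟩
    · exact .inl (.inl rfl)
    · exact .inl (.inr ⟨v, rfl⟩)
    · refine .inr (Set.mem_iUnion.2 ⟨⟨t.val, t.val_lt⟩, ?_⟩)
      rw [row_eq_insert_range hM hx₀ hx₁ F]
      exact .inr ⟨v, rfl⟩
  · refine Set.union_subset ?_ (Set.iUnion_subset fun t => ?_)
    · obtain ⟨m, hm⟩ := exists_image_rectInc_eq (p := p) hM hx₀ hx₁ F (.inl (.inl rfl))
      exact hm ▸ Set.image_subset_range _ _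
    · obtain ⟨m, hm⟩ := exists_image_rectInc_eq (p := p) hM hx₀ hx₁ F
        (.inl (.inr ⟨t, t.2, rfl⟩))
      exact hm ▸ Set.image_subset_range _ _

end RectangleOfRows

/-- Let `V` be a nonzero vector space over `ℤ/p` and let `L_p^V` be embedded in a harmonic
matroid `M`. Then the two descriptions of the point set agree, and the system is a projective
rectangle of order `(p, |V|)` with special point `D`. -/
theorem theorem5p9 (p : ℕ) [Fact p.Prime] (V : Type u) [AddCommGroup V] [Module (ZMod p) V]
    [Nontrivial V] {α : Type v} (M : Matroid α) (hM : IsHarmonic M)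
    (φ : LPoint V → MPoint M) (hφ : IsLpEmbedding M φ) :
    prPoints φ = rowInfty φ ∪ ⋃ t : Fin p, row φ t ∧
      IsProjectiveRectangle (prInc p φ) (prD φ) ∧
      HasOrder (prInc p φ) (prD φ) (p : Cardinal.{u}) (Cardinal.mk V) := by
  obtain ⟨x, hx₀, hx₁, F⟩ := hφ.frame.exists_rows hM
  have R : RectRealization M (φ .D) (rowPoints p φ x) := LpFrame.realization F
  have hrange := range_rectMap_eq_prPoints (p := p) hM hx₀ hx₁ F
  let e : RectPoint p V ≃ prPoints φ := (Equiv.ofInjective _ R.rectMap_injective).trans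
    (Equiv.setCongr hrange)
  let f : RectLine p V ≃ prLines p φ := Equiv.ofBijective
    (fun l => ⟨_, image_rectInc_mem_prLines hM hx₀ hx₁ F l⟩) (by
      constructor
      · intro l l' hl
        refine rectLine_ext (p := p) fun y => ?_
        have := R.rectMap_injective.image_injective (Subtype.ext_iff.1 hl)
        exact Set.ext_iff.1 this y
      · rintro ⟨l, hl⟩
        obtain ⟨m, hm⟩ := exists_image_rectInc_eq hM hx₀ hx₁ F hl
        exact ⟨m, Subtype.ext hm⟩)
  have hef : ∀ y l, prInc p φ (e y) (f l) ↔ rectInc y l := fun y l =>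
    R.rectMap_injective.mem_set_image
  refine ⟨hrange.symm.trans (range_rectMap_eq_rows hM hx₀ hx₁ F),
    (rect_isProjectiveRectangle p V).congr e f hef, ?_⟩
  -- Special lines correspond to `Option (ZMod p)`, and the points of row `∞` to `Option V`, which
  -- accounts for both summands `+ 1`; the lift only matches universes.
  have hp : (p : Cardinal.{u}) = Cardinal.mk (ULift.{u} (ZMod p)) := by simp
  rw [hp]
  refine hasOrder_of_equiv (l := f (.inl none)) ?_ ((hef none _).2 trivial) ?_
  · refine Equiv.trans (Equiv.symm ?_)
      ((rectSpecialEquiv p V).trans (Equiv.optionCongr Equiv.ulift.symm))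
    exact f.subtypeEquiv fun l => (hef none l).symm
  · refine Equiv.trans (Equiv.symm ?_) (rectRowEquiv (p := p) V none)
    exact e.subtypeEquiv fun y => (hef y _).symm
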